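/- Let $n\ge 3$ be an integer and $S=\mathbb{C}[x_1,\dots,x_n]$. For an integer $a\ge 1$ let $$h_a=\sum_{1\le i_1\le\cdots\le i_a\le n}x_{i_1}\cdots x_{i_a},\qquad e_a=\sum_{1\le i_1<\cdots<i_a\le n}x_{i_1}\cdots x_{i_a},\qquad p_a=\sum_{i=1}^n x_i^a$$ be the complete symmetric, elementary symmetric and power sum polynomials of degree $a$. A sequence $y_1,\dots,y_d$ of elements of $S$ is called a regular sequence if the ideal $\langle y_1,\dots,y_d\rangle$ is proper and, for each $0\le i<d$, the image of $y_{i+1}$ is a nonzerodivisor in $S/\langle y_1,\dots,y_i\rangle$. Then: (i) $h_a,h_b$ form a regular sequence in $S$ for all integers $1\le a<b$; (ii) $e_a,e_b$ form a regular sequence in $S$ for all integers $1\le a<b\le n-1$; (iii) $p_a,p_b$ form a regular sequence in $S$ for all integers $1\le a<b$. -/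

import Mathlib

namespace MvPolynomial

/-! For homogeneous f, g of positive degree, regularity reduces to having no common factor
(`isRegular_pair`). A common factor d is excluded by restricting to a line whose direction is not a
zero of f: then d keeps its full degree there, so a nonconstant d has a zero on the line, and at
that point the gradients of f and g are both multiples of that of d. It remains to find, for each
family, a line on which the gradients are independent at every common zero (`isRelPrime_of_line`).
Coordinate lines serve for the `psum` and `hsymm` families, and the line through the n-th roots of
unity in direction (1, ..., 1) for `esymm`. -/

/-! ### Restriction to a line, common factors and regularity -/

lemma natDegree_aeval_line_le {σ R : Type*} [CommRing R] (v w : σ → R) (p : MvPolynomial σ R) :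
    (aeval (fun i => Polynomial.C (v i) + Polynomial.X * Polynomial.C (w i)) p).natDegree ≤ p.totalDegree := by
  rw [aeval_def, eval₂_eq]
  refine Polynomial.natDegree_sum_le_of_forall_le _ _ fun m hm => ?_
  refine (Polynomial.natDegree_C_mul_le _ _).trans ((Polynomial.natDegree_prod_le _ _).trans ?_)
  refine le_trans (Finset.sum_le_sum fun i _ => ?_) (le_totalDegree hm)
  refine Polynomial.natDegree_pow_le_of_le _ (m := 1) ?_ |>.trans (by simp)
  compute_degree

lemma coeff_aeval_line {σ R : Type*} [CommRing R] (v w : σ → R)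
    {p : MvPolynomial σ R} {a : ℕ} (hp : p.IsHomogeneous a) :
    (aeval (fun i => Polynomial.C (v i) + Polynomial.X * Polynomial.C (w i)) p).coeff a = eval w p := by
  rw [aeval_def, eval₂_eq, eval_eq, Polynomial.finsetSum_coeff]
  refine Finset.sum_congr rfl fun m hm => ?_
  have ha : a = ∑ i ∈ m.support, m i := by
    rw [← hp (mem_support_iff.mp hm), Finsupp.weight_apply]
    simp [Finsupp.sum]
  have hdeg : ∀ i, (Polynomial.C (v i) + Polynomial.X * Polynomial.C (w i)).natDegree ≤ 1 := fun i => by compute_degree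
  have hd : ∀ i ∈ m.support, ((Polynomial.C (v i) + Polynomial.X * Polynomial.C (w i)) ^ m i).natDegree ≤ m i := fun i _ =>
    (Polynomial.natDegree_pow_le_of_le _ (hdeg i)).trans (by simp)
  have key : (∏ i ∈ m.support, (Polynomial.C (v i) + Polynomial.X * Polynomial.C (w i)) ^ m i).coeff a
      = ∏ i ∈ m.support, w i ^ m i := by
    have h1 : ∀ s : Finset σ, (∏ i ∈ s, (Polynomial.C (v i) + Polynomial.X * Polynomial.C (w i)) ^ m i).coeff (∑ i ∈ s, m i)
        = ∏ i ∈ s, w i ^ m i := by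
      classical
      intro s
      induction s using Finset.induction_on with
      | empty => simp
      | insert i s hi ih =>
        rw [Finset.prod_insert hi, Finset.sum_insert hi, Finset.prod_insert hi,
          Polynomial.coeff_mul_add_eq_of_natDegree_le, ih]
        · congr 1
          have := Polynomial.coeff_pow_of_natDegree_le (m := m i) (hdeg i)
          rw [mul_one] at this
          rw [this]; simp
        · exact (Polynomial.natDegree_pow_le_of_le _ (hdeg i)).trans (by simp)
        · refine (Polynomial.natDegree_prod_le _ _).trans (Finset.sum_le_sum fun j _ => ?_)
          exact (Polynomial.natDegree_pow_le_of_le _ (hdeg j)).trans (by simp)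
    rw [ha, h1]
  rw [Polynomial.algebraMap_eq, Polynomial.coeff_C_mul, key]

/-- Two polynomials, the first homogeneous, are relatively prime if on some line, whose direction
is not a zero of the first, their gradients are linearly independent at each common zero. -/
theorem isRelPrime_of_line {σ k : Type*} [Field k] [IsAlgClosed k]
    {f g : MvPolynomial σ k} {a : ℕ} (hf : f.IsHomogeneous a) (v w : σ → k) (hw : eval w f ≠ 0)
    (h : ∀ t : k, eval (v + t • w) f = 0 → eval (v + t • w) g = 0 →
      ∃ i j, eval (v + t • w) (pderiv i f) * eval (v + t • w) (pderiv j g) ≠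
        eval (v + t • w) (pderiv j f) * eval (v + t • w) (pderiv i g)) :
    IsRelPrime f g := by
  rintro d ⟨u, rfl⟩ ⟨u', rfl⟩
  have hdu : d * u ≠ 0 := fun h0 => hw (by rw [h0, map_zero])
  obtain ⟨hd, hu⟩ := mul_ne_zero_iff.mp hdu
  set φ := aeval (R := k) (fun i => Polynomial.C (v i) + Polynomial.X * Polynomial.C (w i)) with hφ
  have hev : ∀ (t : k) (p : MvPolynomial σ k), (φ p).eval t = eval (v + t • w) p := by
    intro t p
    rw [← Polynomial.coe_evalRingHom, ← RingHom.coe_coe φ, ← RingHom.comp_apply]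
    congr 1
    refine MvPolynomial.ringHom_ext (fun r => ?_) fun i => ?_
    · simp
    · simp [hφ]
      ring
  -- Restriction raises neither the degree of d nor that of u, and preserves the degree of their
  -- product, so d loses nothing.
  have hdeg : d.totalDegree ≤ (φ d).natDegree := by
    have h1 : a ≤ (φ (d * u)).natDegree :=
      Polynomial.le_natDegree_of_ne_zero (by rwa [hφ, coeff_aeval_line v w hf])
    have h2 := hf.totalDegree hdu
    rw [totalDegree_mul_of_isDomain hd hu] at h2
    rw [map_mul] at h1
    have h3 := h1.trans Polynomial.natDegree_mul_le
    have h4 : (φ u).natDegree ≤ u.totalDegree := natDegree_aeval_line_le v w u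
    omega
  by_cases h0 : d.totalDegree = 0
  · rw [totalDegree_eq_zero_iff_eq_C] at h0
    rw [h0] at hd ⊢
    exact (isUnit_iff_ne_zero.mpr fun hc => hd (by rw [hc, C_0])).map C
  · obtain ⟨t, ht⟩ := IsAlgClosed.exists_root (φ d) (fun hdz => h0 (by
      have := Polynomial.natDegree_eq_zero_iff_degree_le_zero.mpr hdz.le
      omega))
    rw [Polynomial.IsRoot.def, hev] at ht
    obtain ⟨i, j, hij⟩ := h t (by simp [ht]) (by simp [ht])
    refine absurd ?_ hij
    simp only [pderiv_mul, map_add, map_mul, ht]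
    ring

/-- Relatively prime homogeneous polynomials of positive degree form a regular sequence. -/
theorem isRegular_pair {σ k : Type*} [Field k] {f g : MvPolynomial σ k} {a b : ℕ}
    (hf : f.IsHomogeneous a) (hg : g.IsHomogeneous b) (ha : a ≠ 0) (hb : b ≠ 0)
    (h : IsRelPrime f g) : RingTheory.Sequence.IsRegular (MvPolynomial σ k) [f, g] := by
  have key : ∀ {p : MvPolynomial σ k} {c : ℕ}, p.IsHomogeneous c → c ≠ 0 →
      constantCoeff p = 0 := fun hp hc => hp.coeff_eq_zero (by simpa using hc.symm)
  have hf0 : f ≠ 0 := by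
    rintro rfl
    have := (isRelPrime_zero_left.mp h).map constantCoeff
    rw [key hg hb] at this
    exact not_isUnit_zero this
  refine ⟨?_, ?_⟩
  · rw [RingTheory.Sequence.isWeaklyRegular_cons_iff,
      RingTheory.Sequence.isWeaklyRegular_singleton_iff]
    refine ⟨fun x y hxy => mul_left_cancel₀ hf0 hxy, ?_⟩
    rw [isSMulRegular_iff_right_eq_zero_of_smul]
    intro x hx
    obtain ⟨x, rfl⟩ := Submodule.Quotient.mk_surjective _ x
    rw [← Submodule.Quotient.mk_smul, Submodule.Quotient.mk_eq_zero,
      Submodule.mem_smul_pointwise_iff_exists] at hx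
    obtain ⟨y, -, hy⟩ := hx
    obtain ⟨z, rfl⟩ := h.dvd_of_dvd_mul_left (Dvd.intro y hy)
    rw [Submodule.Quotient.mk_eq_zero, Submodule.mem_smul_pointwise_iff_exists]
    exact ⟨z, trivial, rfl⟩
  · intro htop
    have h1 : (1 : MvPolynomial σ k) ∈ Ideal.ofList [f, g] := by
      have : (1 : MvPolynomial σ k) ∈ (Ideal.ofList [f, g] • ⊤ : Ideal (MvPolynomial σ k)) :=
        htop ▸ trivial
      simpa using this
    have h2 : Ideal.ofList [f, g] ≤ RingHom.ker (constantCoeff (σ := σ) (R := k)) := by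
      refine Ideal.span_le.mpr fun x hx => ?_
      simp only [List.mem_cons, List.not_mem_nil, or_false] at hx
      rcases hx with rfl | rfl
      · exact key hf ha
      · exact key hg hb
    simpa using h2 h1


/-! ### Homogeneity, derivatives and values of the three families -/

section psum
variable {σ : Type*} [Fintype σ] {R : Type*} [CommRing R]

lemma psum_isHomogeneous (a : ℕ) : (psum σ R a).IsHomogeneous a :=
  IsHomogeneous.sum _ _ _ fun i _ => by simpa using (isHomogeneous_X R i).pow a

lemma pderiv_psum (i : σ) (a : ℕ) : pderiv i (psum σ R a) = (a : MvPolynomial σ R) *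
      X i ^ (a - 1) := by
  classical
  simp only [psum, map_sum]
  rw [Finset.sum_eq_single i]
  · simp
  · intro j _ hj; simp [pderiv_X_of_ne hj]
  · simp
end psum

section esymm
variable {σ : Type*} [Fintype σ] {R : Type*} [CommRing R]

/-- Splitting by whether i is used gives e_{k+1} = q_{k+1} + x_i q_k with every q_k free of x_i, so
the derivative is q_k. -/
lemma pderiv_esymm_succ (i : σ) (k : ℕ) :
    pderiv i (esymm σ R (k + 1)) = esymm σ R k - X i * pderiv i (esymm σ R k) := by
  classical
  set q : ℕ → MvPolynomial σ R := fun k =>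
    ∑ t ∈ (Finset.univ.erase i).powersetCard k, ∏ j ∈ t, X j with hq
  have hq0 : ∀ k, pderiv i (q k) = 0 := fun k => by
    rw [hq, map_sum]
    refine Finset.sum_eq_zero fun t ht => ?_
    have hi : i ∉ t := fun h => by
      simpa using (Finset.mem_powersetCard.mp ht).1 h
    clear ht
    induction t using Finset.induction_on with
    | empty => simp
    | insert j s hj ih =>
      rw [Finset.mem_insert, not_or] at hi
      rw [Finset.prod_insert hj, pderiv_mul, ih hi.2, pderiv_X_of_ne (Ne.symm hi.1)]
      simp
  have hs : ∀ k, esymm σ R (k + 1) = q (k + 1) + X i * q k := fun k => by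
    rw [esymm, ← Finset.insert_erase (Finset.mem_univ i),
      Finset.powersetCard_succ_insert (Finset.notMem_erase _ _), Finset.sum_union, hq]
    · congr 1
      rw [Finset.sum_image, Finset.mul_sum]
      · refine Finset.sum_congr rfl fun t ht => Finset.prod_insert fun h => ?_
        simpa using (Finset.mem_powersetCard.mp ht).1 h
      · intro s hs t ht hst
        have hs' : i ∉ s := fun h => by simpa using (Finset.mem_powersetCard.mp hs).1 h
        have ht' : i ∉ t := fun h => by simpa using (Finset.mem_powersetCard.mp ht).1 h
        rw [← Finset.erase_insert hs', ← Finset.erase_insert ht', hst]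
    · rw [Finset.disjoint_left]
      intro t ht ht'
      obtain ⟨s, -, rfl⟩ := Finset.mem_image.mp ht'
      simpa using (Finset.mem_powersetCard.mp ht).1 (Finset.mem_insert_self i s)
  have hd : ∀ k, pderiv i (esymm σ R (k + 1)) = q k := fun k => by
    rw [hs, map_add, pderiv_mul, hq0, hq0, pderiv_X_self]; simp
  rw [hd]
  cases k with
  | zero => simp [hq]
  | succ k => rw [hd, hs]; ring

lemma eval_esymm (v : σ → R) (k : ℕ) :
    eval v (esymm σ R k) = ∑ t ∈ Finset.univ.powersetCard k, ∏ i ∈ t, v i := by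
  simp [esymm]
end esymm

section hsymm
variable {σ : Type*} [Fintype σ] [DecidableEq σ] {R : Type*} [CommRing R]

lemma coeff_hsymm (a : ℕ) (m : σ →₀ ℕ) :
    coeff m (hsymm σ R a) = if m.degree = a then 1 else 0 := by
  have hmon : ∀ s : Multiset σ, (s.map X).prod = monomial (R := R) (Multiset.toFinsupp s) 1 := by
    intro s
    induction s using Multiset.induction_on with
    | empty => simp
    | cons i s ih =>
      rw [Multiset.map_cons, Multiset.prod_cons, ih, X, monomial_mul, ← Multiset.singleton_add,
        map_add, Multiset.toFinsupp_singleton, one_mul]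
  rw [hsymm, coeff_sum]
  simp only [hmon, coeff_monomial]
  split_ifs with h
  · have hc : Multiset.card (Finsupp.toMultiset m) = a := by
      rw [Finsupp.card_toMultiset, ← h]; rfl
    refine (Finset.sum_eq_single (⟨Finsupp.toMultiset m, hc⟩ : Sym σ a) ?_
      (fun h => (h (Finset.mem_univ (α := Sym σ a) _)).elim)).trans ?_
    · intro s _ hs
      refine if_neg ?_
      rintro rfl
      exact hs (Subtype.ext (by simp))
    · exact if_pos (by simp)
  · refine Finset.sum_eq_zero fun s _ => if_neg ?_
    rintro rfl
    apply h
    have := Finsupp.card_toMultiset (Multiset.toFinsupp (s : Multiset σ))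
    rw [Multiset.toFinsupp_toMultiset] at this
    exact this.symm.trans s.2

lemma hsymm_isHomogeneous (a : ℕ) : (hsymm σ R a).IsHomogeneous a := by
  intro m hm
  rw [coeff_hsymm] at hm
  rw [show (1 : σ → ℕ) = fun _ => 1 from rfl, ← Finsupp.degree_eq_weight_one]
  by_contra h
  exact hm (if_neg h)

/-- Differentiating 1/∏(1 - x_j T) in x_i multiplies it by T/(1 - x_i T); the proof compares
coefficients. -/
lemma pderiv_hsymm_succ (i : σ) (k : ℕ) :
    pderiv i (hsymm σ R (k + 1)) = hsymm σ R k + X i * pderiv i (hsymm σ R k) := by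
  ext m
  rw [coeff_add, coeff_pderiv, coeff_hsymm, coeff_hsymm, coeff_X_mul']
  have h1 : (m + Finsupp.single i 1).degree = k + 1 ↔ m.degree = k := by simp
  simp only [h1]
  by_cases hi : i ∈ m.support
  · have hm : m - Finsupp.single i 1 + Finsupp.single i 1 = m := by
      refine tsub_add_cancel_of_le (Finsupp.single_le_iff.mpr ?_)
      exact Nat.one_le_iff_ne_zero.mpr (Finsupp.mem_support_iff.mp hi)
    have hmi : (((m - Finsupp.single i 1 : σ →₀ ℕ) i : ℕ) : R) + 1 = m i := by
      have := congrArg (fun f => f i) hm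
      simp only [Finsupp.add_apply, Finsupp.single_eq_same] at this
      rw [← this]; push_cast; rfl
    rw [if_pos hi, coeff_pderiv, hm, coeff_hsymm, hmi]
    split_ifs <;> ring
  · rw [if_neg hi, Finsupp.notMem_support_iff.mp hi]
    simp

lemma eval_hsymm_two_variables [IsDomain R] [CharZero R] {i j : σ} (hij : i ≠ j) (s r : R)
    (k : ℕ) : eval (Pi.single j r + s • Pi.single i 1) (hsymm σ R k) =
      ∑ p ∈ Finset.HasAntidiagonal.antidiagonal k, s ^ p.1 * r ^ p.2 := by
  set P : σ → R := Pi.single j r + s • Pi.single i 1 with hP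
  have hPi : P i = s := by simp [hP, hij]
  have hPj : P j = r := by simp [hP, hij.symm]
  have hPl : ∀ l, l ≠ i ∧ l ≠ j → P l = 0 := fun l hl => by simp [hP, hl.1, hl.2]
  have euler : ∀ k : ℕ, s * eval P (pderiv i (hsymm σ R k)) +
      r * eval P (pderiv j (hsymm σ R k)) = k * eval P (hsymm σ R k) := fun k => by
    have := congrArg (eval P) (hsymm_isHomogeneous (σ := σ) (R := R) k).sum_X_mul_pderiv
    rw [map_sum, Fintype.sum_eq_add i j hij fun l hl => by simp [hPl l hl]] at this
    simpa [hPi, hPj] using this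
  -- The derivative recursion propagates the two partial derivatives; Euler's identity then recovers
  -- the value after division by k + 1.
  suffices h : eval P (hsymm σ R k) = ∑ p ∈ Finset.HasAntidiagonal.antidiagonal k, s ^ p.1 * r ^ p.2 ∧
      s * eval P (pderiv i (hsymm σ R k)) =
        ∑ p ∈ Finset.HasAntidiagonal.antidiagonal k, (p.1 : R) * (s ^ p.1 * r ^ p.2) ∧
      r * eval P (pderiv j (hsymm σ R k)) =
        ∑ p ∈ Finset.HasAntidiagonal.antidiagonal k, (p.2 : R) * (s ^ p.1 * r ^ p.2) from h.1
  induction k with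
  | zero => simp
  | succ k ih =>
    obtain ⟨h1, h2, h3⟩ := ih
    have hu : s * eval P (pderiv i (hsymm σ R (k + 1))) =
        ∑ p ∈ Finset.HasAntidiagonal.antidiagonal (k + 1), (p.1 : R) * (s ^ p.1 * r ^ p.2) := by
      rw [pderiv_hsymm_succ, map_add, map_mul, eval_X, hPi, h2, h1,
        Finset.Nat.sum_antidiagonal_succ, ← Finset.sum_add_distrib, Finset.mul_sum]
      simp only [Nat.cast_zero, zero_mul, zero_add]
      refine Finset.sum_congr rfl fun p _ => ?_
      push_cast; ring
    have hv : r * eval P (pderiv j (hsymm σ R (k + 1))) =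
        ∑ p ∈ Finset.HasAntidiagonal.antidiagonal (k + 1), (p.2 : R) * (s ^ p.1 * r ^ p.2) := by
      rw [pderiv_hsymm_succ, map_add, map_mul, eval_X, hPj, h3, h1,
        Finset.Nat.sum_antidiagonal_succ', ← Finset.sum_add_distrib, Finset.mul_sum]
      simp only [Nat.cast_zero, zero_mul]
      rw [zero_add]
      refine Finset.sum_congr rfl fun p _ => ?_
      push_cast; ring
    refine ⟨?_, hu, hv⟩
    have he := euler (k + 1)
    rw [hu, hv, ← Finset.sum_add_distrib] at he
    refine mul_left_cancel₀ (Nat.cast_ne_zero.mpr k.succ_ne_zero : ((k + 1 : ℕ) : R) ≠ 0) ?_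
    rw [← he, Finset.mul_sum]
    refine Finset.sum_congr rfl fun p hp => ?_
    rw [← Finset.HasAntidiagonal.mem_antidiagonal.mp hp]
    push_cast; ring
end hsymm

lemma esymm_isHomogeneous {σ R : Type*} [Fintype σ] [CommRing R] (a : ℕ) :
    (esymm σ R a).IsHomogeneous a := by
  refine IsHomogeneous.sum _ _ _ fun t ht => ?_
  have := IsHomogeneous.prod t (fun i => (X i : MvPolynomial σ R)) (fun _ => 1)
    fun i _ => isHomogeneous_X R i
  simpa [(Finset.mem_powersetCard.mp ht).2] using this

/-! ### A suitable line for each family -/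

theorem isRelPrime_psum {σ k : Type*} [Fintype σ] [DecidableEq σ] [Field k] [IsAlgClosed k]
    [CharZero k] {i j l : σ} (hij : i ≠ j) (hil : i ≠ l) (hjl : j ≠ l) {a b : ℕ}
    (ha : 1 ≤ a) (hab : a < b) : IsRelPrime (psum σ k a) (psum σ k b) := by
  -- Coordinates i and l stay at 2 and 1 along the line, so that minor of the gradients is
  -- ab(2^(a-1) - 2^(b-1)) up to sign, never zero.
  refine isRelPrime_of_line (psum_isHomogeneous a) (Pi.single i 2 + Pi.single l 1)
    (Pi.single j 1) ?_ fun t _ _ => ⟨i, l, ?_⟩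
  · simp [psum, Pi.single_apply, ite_pow, show a ≠ 0 by omega]
  · have ha0 : (a : k) ≠ 0 := Nat.cast_ne_zero.mpr (by omega)
    have hb0 : (b : k) ≠ 0 := Nat.cast_ne_zero.mpr (by omega)
    simp only [pderiv_psum, map_mul, map_natCast, map_pow, eval_X, Pi.add_apply, Pi.smul_apply,
      Pi.single_eq_same, Pi.single_eq_of_ne hil, Pi.single_eq_of_ne hil.symm,
      Pi.single_eq_of_ne hij, Pi.single_eq_of_ne hjl.symm, smul_zero, add_zero, zero_add, one_pow]
    intro h
    have h2 : (2 : k) ^ (a - 1) = 2 ^ (b - 1) :=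
      mul_left_cancel₀ (mul_ne_zero ha0 hb0) (by linear_combination h)
    have h3 : (2 : ℕ) ^ (a - 1) = 2 ^ (b - 1) := by exact_mod_cast h2
    have := Nat.pow_right_injective le_rfl h3
    omega

/-- The gradient of `hsymm` at its zeros on the line through two coordinate points. -/
lemma eval_pderiv_hsymm_of_eval_eq_zero {σ k : Type*} [Fintype σ] [DecidableEq σ] [Field k]
    [CharZero k] {i j l : σ} (hij : i ≠ j) (hil : i ≠ l) (hjl : j ≠ l) {a : ℕ} (ha : 1 ≤ a)
    {t : k} (h : eval (Pi.single j 1 + t • Pi.single i 1) (hsymm σ k a) = 0) :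
    (t - 1) * t * eval (Pi.single j 1 + t • Pi.single i 1) (pderiv i (hsymm σ k a)) = a + 1 ∧
      t * eval (Pi.single j 1 + t • Pi.single i 1) (pderiv l (hsymm σ k a)) = -1 := by
  have hval := eval_hsymm_two_variables (R := k) hij t 1
  set P : σ → k := Pi.single j 1 + t • Pi.single i 1 with hP
  have hPi : P i = t := by simp [hP, hij]
  have hPl : P l = 0 := by simp [hP, hil.symm, hjl.symm]
  have hs : ∀ m, eval P (hsymm σ k (m + 1)) = 1 + t * eval P (hsymm σ k m) := fun m => by
    rw [hval, hval, Finset.Nat.sum_antidiagonal_succ, Finset.mul_sum]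
    simp [pow_succ']
  have hs' : ∀ m, eval P (hsymm σ k (m + 1)) = eval P (hsymm σ k m) + t ^ (m + 1) := fun m => by
    rw [hval, hval, Finset.Nat.sum_antidiagonal_succ']
    simp [add_comm]
  -- This is t times the t-derivative of (t - 1) h_m = t^(m+1) - 1.
  have hD : ∀ m : ℕ, (t - 1) * t * eval P (pderiv i (hsymm σ k m)) =
      (m + 1) * t ^ (m + 1) - t * eval P (hsymm σ k m) := fun m => by
    induction m with
    | zero => simp
    | succ m ih =>
      rw [pderiv_hsymm_succ, map_add, map_mul, eval_X, hPi]
      push_cast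
      linear_combination t * ih + t * hs' m
  obtain ⟨m, rfl⟩ := Nat.exists_eq_add_of_le' ha
  constructor
  · have h1 : t ^ (m + 2) = 1 := by
      have := hs (m + 1)
      rw [hs' (m + 1), h] at this
      linear_combination this
    rw [hD, h, h1]
    ring
  · rw [pderiv_hsymm_succ, map_add, map_mul, eval_X, hPl]
    linear_combination h - hs m

theorem isRelPrime_hsymm {σ k : Type*} [Fintype σ] [DecidableEq σ] [Field k] [IsAlgClosed k]
    [CharZero k] {i j l : σ} (hij : i ≠ j) (hil : i ≠ l) (hjl : j ≠ l) {a b : ℕ}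
    (ha : 1 ≤ a) (hab : a < b) : IsRelPrime (hsymm σ k a) (hsymm σ k b) := by
  refine isRelPrime_of_line (hsymm_isHomogeneous a) (Pi.single j 1)
    (Pi.single i 1) ?_ fun t hta htb => ⟨i, l, fun h => ?_⟩
  · have := eval_hsymm_two_variables (R := k) hij 1 0 a
    rw [Pi.single_zero, zero_add, one_smul] at this
    rw [this, Finset.sum_eq_single (a, 0)]
    · simp
    · rintro ⟨p, q⟩ hp hne
      have hpq := Finset.HasAntidiagonal.mem_antidiagonal.mp hp
      have : q ≠ 0 := by
        rintro rfl
        exact hne (by simpa using hpq)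
      simp [this]
    · simp
  · obtain ⟨a1, a2⟩ := eval_pderiv_hsymm_of_eval_eq_zero hij hil hjl ha hta
    obtain ⟨b1, b2⟩ := eval_pderiv_hsymm_of_eval_eq_zero hij hil hjl (ha.trans hab.le) htb
    -- Dependent gradients would force a + 1 = b + 1.
    have h1 := congrArg₂ (· * ·) a1 b2
    have h2 := congrArg₂ (· * ·) b1 a2
    have h3 : (a : k) = b := by
      linear_combination h1 - h2 - (t - 1) * t * t * h
    exact hab.ne (by exact_mod_cast h3)

/-- The product of the X + t - ω^i is (X + t)^n - 1, which differs from (X + t)^n only in the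
constant term, that is, only in e_n. -/
lemma eval_esymm_rootsOfUnity {k : Type*} [Field k] {n : ℕ} {ω : k} (hω : IsPrimitiveRoot ω n)
    (t : k) {a : ℕ} (ha : 1 ≤ a) (han : a < n) :
    eval ((fun i : Fin n => -ω ^ (i : ℕ)) + t • (1 : Fin n → k)) (esymm (Fin n) k a) =
      t ^ a * n.choose a := by
  have hn : 0 < n := by omega
  have hprod : ∏ i : Fin n, (Polynomial.X + Polynomial.C (-ω ^ (i : ℕ) + t)) =
      (Polynomial.X + Polynomial.C t) ^ n - 1 := by
    have h1 := congrArg (fun p => p.comp (Polynomial.X + Polynomial.C t))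
      (X_pow_sub_C_eq_prod hω hn (one_pow n))
    simp only [Polynomial.sub_comp, Polynomial.pow_comp, Polynomial.X_comp, Polynomial.C_comp,
      Polynomial.prod_comp, mul_one, map_one, Polynomial.one_comp] at h1
    rw [h1, Finset.prod_range]
    refine Finset.prod_congr rfl fun i _ => ?_
    simp only [map_add, map_neg]
    ring
  have hc := congrArg (fun p => p.coeff (n - a)) hprod
  rw [Finset.prod_X_add_C_coeff _ _ (by simp), Finset.card_univ, Fintype.card_fin,
    Nat.sub_sub_self han.le, Polynomial.coeff_sub, Polynomial.coeff_X_add_C_pow,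
    Polynomial.coeff_one, if_neg (by omega), sub_zero, Nat.sub_sub_self han.le,
    Nat.choose_symm han.le] at hc
  rw [eval_esymm, ← hc]
  simp

theorem isRelPrime_esymm {k : Type*} [Field k] [IsAlgClosed k] [CharZero k] {n : ℕ} (hn : 2 ≤ n)
    {a b : ℕ} (ha : 1 ≤ a) (hab : a < b) (hbn : b < n) :
    IsRelPrime (esymm (Fin n) k a) (esymm (Fin n) k b) := by
  have : NeZero (n : k) := ⟨Nat.cast_ne_zero.mpr (by omega)⟩
  obtain ⟨ω, hω⟩ := HasEnoughRootsOfUnity.exists_primitiveRoot k n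
  have hval := fun c (hc : 1 ≤ c) hcn t => eval_esymm_rootsOfUnity hω t (a := c) hc hcn
  have hchoose : (n.choose a : k) ≠ 0 := Nat.cast_ne_zero.mpr (Nat.choose_pos (by omega)).ne'
  refine isRelPrime_of_line (esymm_isHomogeneous a) (fun i => -ω ^ (i : ℕ)) 1 ?_
    fun t hta htb => ⟨⟨0, by omega⟩, ⟨1, by omega⟩, ?_⟩
  · rw [eval_esymm]
    simpa using hchoose
  · rw [hval a ha (by omega), mul_eq_zero, or_iff_left hchoose] at hta
    obtain rfl := eq_zero_of_pow_eq_zero hta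
    -- At t = 0 the values e_1, ..., e_{n-1} vanish, so each step of the derivative recursion just
    -- multiplies by -x_i = ω^i.
    have hD : ∀ (i : Fin n) (c : ℕ), c + 1 < n →
        eval ((fun i : Fin n => -ω ^ (i : ℕ)) + (0 : k) • 1) (pderiv i (esymm (Fin n) k (c + 1))) =
          (ω ^ (i : ℕ)) ^ c := fun i c hc => by
      induction c with
      | zero => rw [pderiv_esymm_succ]; simp
      | succ c ih =>
        rw [pderiv_esymm_succ, map_sub, map_mul, ih (by omega), hval (c + 1) (by omega) (by omega)]
        simp [pow_succ']
    obtain ⟨a, rfl⟩ := Nat.exists_eq_add_of_le' ha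
    obtain ⟨b, rfl⟩ := Nat.exists_eq_add_of_le' (ha.trans hab.le)
    rw [hD _ a (by omega), hD _ b (by omega), hD _ a (by omega), hD _ b (by omega)]
    simp only [pow_zero, one_pow, pow_one, one_mul, mul_one]
    intro h
    have := hω.pow_inj (by omega) (by omega) h
    omega

end MvPolynomial

open MvPolynomial in
theorem mainTheorem5 (n : ℕ) (hn : 3 ≤ n) :
    (∀ a b : ℕ, 1 ≤ a → a < b →
      RingTheory.Sequence.IsRegular (MvPolynomial (Fin n) ℂ)
        [MvPolynomial.hsymm (Fin n) ℂ a, MvPolynomial.hsymm (Fin n) ℂ b]) ∧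
    (∀ a b : ℕ, 1 ≤ a → a < b → b ≤ n - 1 →
      RingTheory.Sequence.IsRegular (MvPolynomial (Fin n) ℂ)
        [MvPolynomial.esymm (Fin n) ℂ a, MvPolynomial.esymm (Fin n) ℂ b]) ∧
    (∀ a b : ℕ, 1 ≤ a → a < b →
      RingTheory.Sequence.IsRegular (MvPolynomial (Fin n) ℂ)
        [MvPolynomial.psum (Fin n) ℂ a, MvPolynomial.psum (Fin n) ℂ b]) := by
  have h01 : (⟨0, by omega⟩ : Fin n) ≠ ⟨1, by omega⟩ := by simp
  have h02 : (⟨0, by omega⟩ : Fin n) ≠ ⟨2, by omega⟩ := by simp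
  have h12 : (⟨1, by omega⟩ : Fin n) ≠ ⟨2, by omega⟩ := by simp
  refine ⟨fun a b ha hab => ?_, fun a b ha hab hb => ?_, fun a b ha hab => ?_⟩
  · exact isRegular_pair (hsymm_isHomogeneous a) (hsymm_isHomogeneous b) (by omega) (by omega)
      (isRelPrime_hsymm h01 h02 h12 ha hab)
  · exact isRegular_pair (esymm_isHomogeneous a) (esymm_isHomogeneous b) (by omega) (by omega)
      (isRelPrime_esymm (by omega) ha hab (by omega))
  · exact isRegular_pair (psum_isHomogeneous a) (psum_isHomogeneous b) (by omega) (by omega)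
      (isRelPrime_psum h01 h02 h12 ha hab)
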